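/- Let $n = 4m+2$ with $m \ge 1$ an integer. For $x \in \{-1,1\}^n$ write $x = (x_L, x_R)$, where $x_L$ is the first $2m+1$ and $x_R$ the last $2m+1$ coordinates, put $L(x) = x_1 + \dots + x_{2m+1}$, $R(x) = x_{2m+2} + \dots + x_{4m+2}$, and let $|x_L|$, $|x_R|$ denote Hamming weights (the number of coordinates equal to $-1$, which encodes the bit $1$). The Boolean Imbalance function $\mathrm{BI}_n$ is the partial Boolean function $x \mapsto L(x)/R(x) \in \{-1,1\}$ with domain $S_- \cup S_+$, where $$S_+ = \{x : |x_L| = |x_R| = m\}, \qquad S_- = \{x : |x_L| + |x_R| = 2m+1,\ |x_L| \ge m,\ |x_R| \ge m\}.$$ For a partial Boolean function $f : D \to \{-1,1\}$, $D \subseteq \{-1,1\}^n$: the rational degree $\mathrm{rdeg}(f)$ is the minimum of $\max\{\deg p, \deg q\}$ over real polynomials $p, q$ such that $q(x) \ne 0$ and $f(x) = p(x)/q(x)$ for all $x \in D$; the approximate degree $\widetilde{\deg}(f)$ is the minimum degree of a real polynomial $p$ with $|p(x) - f(x)| \le 1/3$ for all $x \in D$ and $|p(x)| \le 1$ for all $x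 \in \{-1,1\}^n$. A $T$-query quantum algorithm starts in a fixed basis state and applies input-independent unitaries interleaved with $T$ applications of the query unitary $|i\rangle|b\rangle \mapsto |i\rangle|b \oplus x_i\rangle$ (bits being encoded by $0 \mapsto 1$, $1 \mapsto -1$). $\mathrm{Q}(f)$ is the minimum $T$ for which some such algorithm has a measured output bit $a(x)$ with $\Pr[a(x) = f(x)] \ge 2/3$ for all $x \in D$. $\mathrm{PostQ}_E(f)$ is the minimum $T$ for which some such algorithm with measured output bit $a(x)$ and measured post-selection bit $b(x)$ satisfies $\Pr[b(x) = 1] > 0$ and $\Pr[a(x) = f(x) \mid b(x) = 1] = 1$ for all $x \in D$; one then says that the algorithm decides $f$ with post-selection and zero error. **Lemma.** For every $n = 4m+2$ with $m \ge 1$, $\mathrm{BI}_n$ is decided with zero error by a post-selected quantum algorithm that makes $2$ queries. Moreover, with implied constants that do not depend on $n$, $$\mathrm{rdeg}(\mathrm{BI}_n) \le O(1) \quad\text{yet}\quad \widetilde{\deg}(\mathrm{BI}_n) \ge \Omega(n),$$ $$\mathrm{PostQ}_E(\mathrm{BI}_n) \le O(1) \quad\text{yet}\quad \mathrm{Q}(\mathrm{BI}_n)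 \ge \Omega(n).$$ -/

import Mathlib

open scoped ENNReal

namespace BooleanImbalance

/-- The Boolean hypercube `{-1,1}^n`; `ℤˣ` is the two-element set `{1, -1}`. -/
abbrev Cube (n : ℕ) : Type := Fin n → ℤˣ

/-- An element of `{-1,1}` as a real number. -/
def toReal (s : ℤˣ) : ℝ := ((s : ℤ) : ℝ)

/-- A partial Boolean function `f : D → {-1,1}` with `D ⊆ {-1,1}^n`. -/
structure PartialBoolFun (n : ℕ) where
  /-- the domain `D` -/
  dom : Set (Cube n)
  /-- the values on `D` -/
  val : dom → ℝ
  val_eq : ∀ x, val x = 1 ∨ val x = -1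

/-! ### Polynomial degree measures

The degrees are minima over sets of natural numbers, taken in `ℕ∞`, so that the minimum over the
empty set is `⊤`. -/

/-- The value of a real polynomial at a point of the hypercube. -/
noncomputable def evalCube {n : ℕ} (p : MvPolynomial (Fin n) ℝ) (x : Cube n) : ℝ :=
  MvPolynomial.eval (fun i => toReal (x i)) p

/-- `p` `ε`-approximates `f`: it is `ε`-close to `f` on the domain of `f`, and it is bounded by `1`
in absolute value on the whole hypercube. -/
def Approximates {n : ℕ} (ε : ℝ) (p : MvPolynomial (Fin n) ℝ) (f : PartialBoolFun n) : Prop :=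
  (∀ x : f.dom, |evalCube p x - f.val x| ≤ ε) ∧ ∀ x : Cube n, |evalCube p x| ≤ 1

/-- The `ε`-approximate degree of `f`. -/
noncomputable def approxDegEps {n : ℕ} (ε : ℝ) (f : PartialBoolFun n) : ℕ∞ :=
  ⨅ (p : MvPolynomial (Fin n) ℝ) (_ : Approximates ε p f), (p.totalDegree : ℕ∞)

/-- The approximate degree of `f`. -/
noncomputable def approxDeg {n : ℕ} (f : PartialBoolFun n) : ℕ∞ := approxDegEps (1 / 3) f

/-- `p / q` is an `ε`-approximate rational representation of `f`. -/
def RationallyApproximates {n : ℕ} (ε : ℝ) (p q : MvPolynomial (Fin n) ℝ)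
    (f : PartialBoolFun n) : Prop :=
  ∀ x : f.dom, evalCube q x ≠ 0 ∧ |f.val x - evalCube p x / evalCube q x| ≤ ε

/-- The `ε`-approximate rational degree of `f`. -/
noncomputable def ratDegEps {n : ℕ} (ε : ℝ) (f : PartialBoolFun n) : ℕ∞ :=
  ⨅ (p : MvPolynomial (Fin n) ℝ) (q : MvPolynomial (Fin n) ℝ)
    (_ : RationallyApproximates ε p q f), ((max p.totalDegree q.totalDegree : ℕ) : ℕ∞)

/-- The rational degree of `f`. -/
noncomputable def ratDeg {n : ℕ} (f : PartialBoolFun n) : ℕ∞ := ratDegEps 0 f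

/-! ### Quantum query algorithms -/

/-- The computational basis of the register of a query algorithm with `k` ancilla qubits: a basis
state `|a⟩|s⟩|i⟩|b⟩|z⟩` consists of the output qubit `a` (labelled by `1, -1`), the post-selection
qubit `s`, the query index `i`, the query target qubit `b` (labelled by `1, -1`), and the
ancillas `z`. -/
abbrev RegisterBasis (n k : ℕ) : Type := ℤˣ × Bool × Fin n × ℤˣ × (Fin k → Bool)

/-- Vectors in the Hilbert space spanned by the register basis. -/
abbrev RegisterState (n k : ℕ) : Type := RegisterBasis n k → ℂ

/-- A quantum algorithm that makes `T` queries to an input in `{-1,1}^n`: it starts in a fixed basis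
state and applies `U₀, O_x, U₁, O_x, …, O_x, U_T`, where the unitaries `U_t` do not depend on `x`
and `O_x` is the query unitary. -/
structure QueryAlgorithm (n T : ℕ) where
  /-- the number of ancilla qubits -/
  ancillas : ℕ
  /-- the initial basis state -/
  init : RegisterBasis n ancillas
  /-- the unitaries between the queries -/
  unitary : Fin (T + 1) → Matrix.unitaryGroup (RegisterBasis n ancillas) ℂ

/-- The query unitary `O_x`, which maps `|a⟩|s⟩|i⟩|b⟩|z⟩` to `|a⟩|s⟩|i⟩|b ⊕ x_i⟩|z⟩`. In the
`{1,-1}` labelling of bits, `⊕` is multiplication. The basis permutation is its own inverse, so it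
acts on amplitudes by the formula below. -/
def applyQuery {n k : ℕ} (x : Cube n) (ψ : RegisterState n k) : RegisterState n k :=
  fun v => ψ (v.1, v.2.1, v.2.2.1, v.2.2.2.1 * x v.2.2.1, v.2.2.2.2)

namespace QueryAlgorithm

variable {n T : ℕ}

/-- The state after `t` queries, and after the unitary `U_t` that follows them. -/
noncomputable def stateAfter (A : QueryAlgorithm n T) (x : Cube n) :
    (t : ℕ) → t ≤ T → RegisterState n A.ancillas
  | 0, _ => (A.unitary 0).1.mulVec (Pi.single A.init 1)
  | t + 1, h => (A.unitary ⟨t + 1, Nat.lt_succ_of_le h⟩).1.mulVec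
      (applyQuery x (A.stateAfter x t (Nat.le_of_succ_le h)))

/-- The state at the end of the computation on input `x`. -/
noncomputable def finalState (A : QueryAlgorithm n T) (x : Cube n) : RegisterState n A.ancillas :=
  A.stateAfter x T le_rfl

open Classical in
/-- The probability that measuring the final state in the computational basis gives a basis state
in the set `E`. -/
noncomputable def prob (A : QueryAlgorithm n T) (x : Cube n)
    (E : Set (RegisterBasis n A.ancillas)) : ℝ :=
  ∑ v : RegisterBasis n A.ancillas, if v ∈ E then ‖A.finalState x v‖ ^ 2 else 0

/-- `A` computes `f` with error `ε`: on each input `x` in the domain of `f`, the measured output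
bit equals `f x` with probability at least `1 - ε`. -/
def Computes (A : QueryAlgorithm n T) (ε : ℝ) (f : PartialBoolFun n) : Prop :=
  ∀ x : f.dom, 1 - ε ≤ A.prob x {v | toReal v.1 = f.val x}

/-- `A` with post-selection computes `f` with error `ε`: on each input `x` in the domain of `f`, the
post-selection bit is `1` with positive probability and, conditioned on this, the output bit equals
`f x` with probability at least `1 - ε`. -/
def PostComputes (A : QueryAlgorithm n T) (ε : ℝ) (f : PartialBoolFun n) : Prop :=
  ∀ x : f.dom, 0 < A.prob x {v | v.2.1 = true} ∧
    1 - ε ≤ A.prob x {v | toReal v.1 = f.val x ∧ v.2.1 = true} / A.prob x {v | v.2.1 = true}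

end QueryAlgorithm

/-- The `ε`-error quantum query complexity of `f`. -/
noncomputable def quantumQueryEps {n : ℕ} (ε : ℝ) (f : PartialBoolFun n) : ℕ∞ :=
  ⨅ (T : ℕ) (_ : ∃ A : QueryAlgorithm n T, A.Computes ε f), (T : ℕ∞)

/-- The bounded-error quantum query complexity `Q(f)`. -/
noncomputable def quantumQuery {n : ℕ} (f : PartialBoolFun n) : ℕ∞ := quantumQueryEps (1 / 3) f

/-- The `ε`-error post-selected quantum query complexity of `f`. -/
noncomputable def postQueryEps {n : ℕ} (ε : ℝ) (f : PartialBoolFun n) : ℕ∞ :=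
  ⨅ (T : ℕ) (_ : ∃ A : QueryAlgorithm n T, A.PostComputes ε f), (T : ℕ∞)

/-- The zero-error post-selected quantum query complexity `PostQ_E(f)`. -/
noncomputable def postQueryExact {n : ℕ} (f : PartialBoolFun n) : ℕ∞ := postQueryEps 0 f

/-! ### The Boolean Imbalance function -/

/-- The first `2m+1` of the `4m+2` coordinates. -/
def leftHalf (m : ℕ) : Finset (Fin (4 * m + 2)) := Finset.univ.filter fun i => i.val < 2 * m + 1

/-- The last `2m+1` of the `4m+2` coordinates. -/
def rightHalf (m : ℕ) : Finset (Fin (4 * m + 2)) := Finset.univ.filter fun i => 2 * m + 1 ≤ i.val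

/-- The sum of the coordinates of `x` in `s`. -/
noncomputable def partSum {n : ℕ} (s : Finset (Fin n)) (x : Cube n) : ℝ := ∑ i ∈ s, toReal (x i)

/-- The Hamming weight of the part of `x` in `s`: the number of coordinates equal to `-1`, the
element of `{1,-1}` that stands for the bit `1`. -/
def partWeight {n : ℕ} (s : Finset (Fin n)) (x : Cube n) : ℕ := (s.filter fun i => x i = -1).card

/-- The Imbalance function `L(x) / R(x)`. -/
noncomputable def imbalance (m : ℕ) (x : Cube (4 * m + 2)) : ℝ :=
  partSum (leftHalf m) x / partSum (rightHalf m) x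

/-- The inputs with `|x_L| = |x_R| = m`. -/
def sPlus (m : ℕ) : Set (Cube (4 * m + 2)) :=
  {x | partWeight (leftHalf m) x = m ∧ partWeight (rightHalf m) x = m}

/-- The inputs with `|x_L| + |x_R| = 2m+1` and `|x_L|, |x_R| ≥ m`. -/
def sMinus (m : ℕ) : Set (Cube (4 * m + 2)) :=
  {x | partWeight (leftHalf m) x + partWeight (rightHalf m) x = 2 * m + 1 ∧
    m ≤ partWeight (leftHalf m) x ∧ m ≤ partWeight (rightHalf m) x}

theorem partSum_eq {n : ℕ} (s : Finset (Fin n)) (x : Cube n) :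
    partSum s x = s.card - 2 * partWeight s x := by
  have h : ∀ i ∈ s, toReal (x i) = 1 - 2 * (if x i = -1 then (1 : ℝ) else 0) := by
    intro i _
    rcases Int.units_eq_one_or (x i) with h | h
    · rw [h, if_neg (by decide)]; simp [toReal]
    · rw [h]; norm_num [toReal]
  unfold partSum partWeight
  rw [Finset.sum_congr rfl h, Finset.sum_sub_distrib, ← Finset.mul_sum]
  simp

theorem card_leftHalf (m : ℕ) : (leftHalf m).card = 2 * m + 1 := by
  unfold leftHalf
  rw [Fin.card_filter_val_lt]
  omega

theorem card_rightHalf (m : ℕ) : (rightHalf m).card = 2 * m + 1 := by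
  have h := Finset.card_filter_add_card_filter_not (s := (Finset.univ : Finset (Fin (4 * m + 2))))
    (fun i => i.val < 2 * m + 1)
  have hl := card_leftHalf m
  unfold leftHalf at hl
  unfold rightHalf
  simp only [not_lt, Finset.card_univ, Fintype.card_fin] at h
  omega

theorem imbalance_of_mem_sPlus {m : ℕ} {x : Cube (4 * m + 2)} (hx : x ∈ sPlus m) :
    imbalance m x = 1 := by
  obtain ⟨h1, h2⟩ := hx
  rw [imbalance, partSum_eq, partSum_eq, card_leftHalf, card_rightHalf, h1, h2]
  push_cast
  ring_nf

theorem imbalance_of_mem_sMinus {m : ℕ} {x : Cube (4 * m + 2)} (hx : x ∈ sMinus m) :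
    imbalance m x = -1 := by
  obtain ⟨h0, h1, h2⟩ := hx
  rw [imbalance, partSum_eq, partSum_eq, card_leftHalf, card_rightHalf]
  have h : (partWeight (leftHalf m) x = m ∧ partWeight (rightHalf m) x = m + 1) ∨
      (partWeight (leftHalf m) x = m + 1 ∧ partWeight (rightHalf m) x = m) := by omega
  rcases h with ⟨h3, h4⟩ | ⟨h3, h4⟩ <;>
  · rw [h3, h4]
    push_cast
    ring_nf

/-- The Boolean Imbalance function `BI_n`, `n = 4m+2`: the restriction of the Imbalance function to
the union of `sPlus` and `sMinus`. -/
noncomputable def boolImbalance (m : ℕ) : PartialBoolFun (4 * m + 2) where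
  dom := sMinus m ∪ sPlus m
  val x := imbalance m x
  val_eq x := x.2.elim (fun h => Or.inr (imbalance_of_mem_sMinus h))
    (fun h => Or.inl (imbalance_of_mem_sPlus h))

end BooleanImbalance

namespace BooleanImbalance

/-! On the domain both half sums are `1` or `-1`, so the function is a quotient `L / R` of two
linear forms, which gives the rational degree. The same fact gives the post-selected algorithm. The
vector with entries `x i / √n` has overlap `(L + R) / n` with the uniform unit vector and `(L - R) /
n` with the unit vector that is positive on the left half and negative on the right. A unitary sends
these two vectors to flag states carrying the outputs `1` and `-1`. Since `L = ±R ≠ 0`, exactly one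
flag amplitude is nonzero, and it is the one with the correct output.

Both lower bounds come from `le_of_mem_degreeLE`. Fix a right half of weight `m` and average over
the left halves of weight `k`. This symmetrization (`exists_polynomial_sum_powersetCard`) turns a
bounded function of degree `d` on the cube into a polynomial `P` of degree at most `d` with `|P(k)|
≤ 1` for `k = 0, …, 2m+1`, `P(m) ≥ 1/3` and `P(m+1) ≤ -1/3`. Such a jump in the middle of the
interval forces degree linear in `m` (`eval_zero_lt_of_natDegree_lt`): after a shift by `m`,
Lagrange interpolation from sparse nodes would make the value at `0` less than `1/3` if the degree
were small. For quantum algorithms the polynomial method applies: output probabilities after `T`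
queries have degree at most `2T`, and conservation of norm bounds them on the whole cube. -/

/-! ### A polynomial that jumps in the middle of a long interval has large degree -/

/-- The nonzero integers of absolute value at most `r`. -/
noncomputable def puncturedIcc (r : ℕ) : Finset ℤ := (Finset.Icc (-(r : ℤ)) r).erase 0

theorem mem_puncturedIcc {r : ℕ} {j : ℤ} : j ∈ puncturedIcc r ↔ j ≠ 0 ∧ |j| ≤ r := by
  simp [puncturedIcc, abs_le]

theorem card_puncturedIcc (r : ℕ) : (puncturedIcc r).card = 2 * r := by
  rw [puncturedIcc, Finset.card_erase_of_mem (by simp), Int.card_Icc]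
  omega

theorem puncturedIcc_succ (r : ℕ) :
    puncturedIcc (r + 1) = insert ((r : ℤ) + 1) (insert (-((r : ℤ) + 1)) (puncturedIcc r)) := by
  ext j
  simp only [mem_puncturedIcc, Finset.mem_insert, abs_le]
  push_cast
  omega

theorem prod_puncturedIcc_succ {M : Type*} [CommMonoid M] (r : ℕ) (f : ℤ → M) :
    ∏ j ∈ puncturedIcc (r + 1), f j =
      f (r + 1) * (f (-(r + 1)) * ∏ j ∈ puncturedIcc r, f j) := by
  rw [puncturedIcc_succ, Finset.prod_insert, Finset.prod_insert]
  · simp only [mem_puncturedIcc, abs_le]; omega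
  · simp only [mem_puncturedIcc, abs_le, Finset.mem_insert]; omega

theorem sum_puncturedIcc_succ {M : Type*} [AddCommMonoid M] (r : ℕ) (f : ℤ → M) :
    ∑ j ∈ puncturedIcc (r + 1), f j =
      f (r + 1) + (f (-(r + 1)) + ∑ j ∈ puncturedIcc r, f j) := by
  rw [puncturedIcc_succ, Finset.sum_insert, Finset.sum_insert]
  · simp only [mem_puncturedIcc, abs_le]; omega
  · simp only [mem_puncturedIcc, abs_le, Finset.mem_insert]; omega

/-- Telescoping: the terms at `±(r+1)` add `2/(r+1)^2`, which is less than `4/(2r+1) - 4/(2r+3)`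
because `(2r+1)(2r+3) = 4(r+1)^2 - 1`. -/
theorem sum_inv_sq_puncturedIcc_le (r : ℕ) :
    ∑ j ∈ puncturedIcc r, (1 : ℝ) / (j : ℝ) ^ 2 ≤ 4 - 4 / (2 * r + 1) := by
  induction r with
  | zero => simp [puncturedIcc]
  | succ r ih =>
    rw [sum_puncturedIcc_succ]
    push_cast
    rw [neg_sq]
    have hr : (0 : ℝ) ≤ r := r.cast_nonneg
    have h : (4 : ℝ) / (2 * r + 1) - 4 / (2 * (r + 1) + 1) - 2 * (1 / (r + 1) ^ 2) =
        2 / ((2 * r + 1) * (2 * (r + 1) + 1) * (r + 1) ^ 2) := by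
      field_simp
      ring
    have h' : (0 : ℝ) ≤ 2 / ((2 * r + 1) * (2 * (r + 1) + 1) * (r + 1) ^ 2) := by positivity
    linarith

/-- The factors at `j` and `-j` are paired into `16j^2/(16j^2 - 1)`. The rational bound is chosen to
close the induction: it equals `1` at `r = 0` and stays below `4/3`. -/
theorem prod_four_mul_div_puncturedIcc (r : ℕ) :
    0 ≤ ∏ j ∈ puncturedIcc r, (4 * j : ℝ) / (4 * j + 1) ∧
    ∏ j ∈ puncturedIcc r, (4 * j : ℝ) / (4 * j + 1) ≤ (4 * r + 3) / (3 * r + 3) := by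
  induction r with
  | zero => simp [puncturedIcc]
  | succ r ih =>
    obtain ⟨h0, h1⟩ := ih
    rw [prod_puncturedIcc_succ, ← mul_assoc]
    push_cast
    set Q := ∏ j ∈ puncturedIcc r, (4 * j : ℝ) / (4 * j + 1)
    have hr : (0 : ℝ) ≤ r := r.cast_nonneg
    have e : 4 * ((r : ℝ) + 1) / (4 * (r + 1) + 1) * (4 * -((r : ℝ) + 1) / (4 * -(r + 1) + 1)) =
        16 * (r + 1) ^ 2 / ((4 * r + 5) * (4 * r + 3)) := by
      have : 4 * -((r : ℝ) + 1) + 1 = -(4 * r + 3) := by ring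
      rw [this]
      field_simp
      ring
    rw [e]
    refine ⟨by positivity, (mul_le_mul_of_nonneg_left h1 (by positivity)).trans ?_⟩
    rw [div_mul_div_comm, div_le_div_iff₀ (by positivity) (by positivity)]
    nlinarith [mul_nonneg hr hr, mul_nonneg (mul_nonneg hr hr) hr]

/-- The right side is the product of `|i|` over the reflected set `B = j - A`, which has as many
elements as `A`. The common elements cancel; those left in `A` have absolute value at most `r`,
those left in `B` more than `r`. -/
theorem prod_abs_le_prod_abs_sub {r : ℕ} {j : ℤ} :
    ∏ i ∈ (puncturedIcc r).erase j, |(i : ℝ)| ≤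
      ∏ i ∈ (puncturedIcc r).erase j, |(j : ℝ) - i| := by
  set A := (puncturedIcc r).erase j
  set B := A.image (fun i => j - i)
  have hB : ∏ i ∈ A, |(j : ℝ) - i| = ∏ i ∈ B, |(i : ℝ)| := by
    rw [Finset.prod_image (by intro a _ b _ h; simpa using h)]
    simp
  have hcard : B.card = A.card := Finset.card_image_of_injective _ sub_right_injective
  have hAB : (A \ B).card = (B \ A).card := by
    have h1 := Finset.card_sdiff_add_card_inter A B
    have h2 := Finset.card_sdiff_add_card_inter B A
    rw [Finset.inter_comm] at h2
    omega
  rw [hB, ← Finset.prod_inter_mul_prod_sdiff A B, ← Finset.prod_inter_mul_prod_sdiff B A,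
    Finset.inter_comm B A]
  refine mul_le_mul_of_nonneg_left ?_ (Finset.prod_nonneg fun _ _ => abs_nonneg _)
  have h1 : ∏ i ∈ A \ B, |(i : ℝ)| ≤ (r : ℝ) ^ (A \ B).card := by
    rw [← Finset.prod_const]
    refine Finset.prod_le_prod (fun _ _ => abs_nonneg _) fun i hi => ?_
    exact_mod_cast (mem_puncturedIcc.1 (Finset.mem_of_mem_erase (Finset.mem_sdiff.1 hi).1)).2
  have h2 : (r : ℝ) ^ (B \ A).card ≤ ∏ i ∈ B \ A, |(i : ℝ)| := by
    rw [← Finset.prod_const]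
    refine Finset.prod_le_prod (fun _ _ => r.cast_nonneg) fun i hi => ?_
    obtain ⟨hiB, hiA⟩ := Finset.mem_sdiff.1 hi
    obtain ⟨k, hk, rfl⟩ := Finset.mem_image.1 hiB
    obtain ⟨hkj, hk⟩ := Finset.mem_erase.1 hk
    obtain ⟨hk0, -⟩ := mem_puncturedIcc.1 hk
    have : ¬ |j - k| ≤ r := fun h => hiA <| Finset.mem_erase.2
      ⟨by omega, mem_puncturedIcc.2 ⟨by omega, h⟩⟩
    exact_mod_cast (not_le.1 this).le
  exact h1.trans (hAB ▸ h2)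

/-! ### Lagrange interpolation at `0` from sparse nodes -/

/-- The interpolation nodes: `1`, `-5`, and the nonzero multiples `20 j` of `20` with `|j| ≤ r`. -/
noncomputable def jumpNodes (r : ℕ) : Finset ℤ :=
  insert 1 (insert (-5) ((puncturedIcc r).image (20 * ·)))

theorem one_notMem (r : ℕ) :
    (1 : ℤ) ∉ insert (-5) ((puncturedIcc r).image (20 * ·)) := by
  simp only [Finset.mem_insert, Finset.mem_image, not_or, not_exists, not_and]
  exact ⟨by norm_num, fun _ _ => by omega⟩

theorem neg_five_notMem (r : ℕ) : (-5 : ℤ) ∉ (puncturedIcc r).image (20 * ·) := by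
  simp only [Finset.mem_image, not_exists, not_and]
  exact fun _ _ => by omega

theorem card_jumpNodes (r : ℕ) : (jumpNodes r).card = 2 * r + 2 := by
  rw [jumpNodes, Finset.card_insert_of_notMem (one_notMem r),
    Finset.card_insert_of_notMem (neg_five_notMem r), Finset.card_image_of_injective _
      (mul_right_injective₀ (by norm_num)), card_puncturedIcc]

/-- The coefficient of the node `i` in the Lagrange interpolation formula at `0`. -/
noncomputable def jumpCoeff (r : ℕ) (i : ℤ) : ℝ :=
  ∏ j ∈ (jumpNodes r).erase i, (j : ℝ) / (j - i)

theorem eval_zero_eq_sum_jumpCoeff {r : ℕ} {P : Polynomial ℝ} (hP : P.natDegree < 2 * r + 2) :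
    P.eval 0 = ∑ i ∈ jumpNodes r, P.eval (i : ℝ) * jumpCoeff r i := by
  have hdeg : P.degree < (jumpNodes r).card := by
    rw [card_jumpNodes]
    exact Polynomial.degree_le_natDegree.trans_lt (by exact_mod_cast hP)
  conv_lhs => rw [Lagrange.eq_interpolate (v := fun i : ℤ => (i : ℝ))
    Int.cast_injective.injOn hdeg]
  rw [Lagrange.interpolate_apply, Polynomial.eval_finsetSum]
  refine Finset.sum_congr rfl fun i _ => ?_
  rw [Polynomial.eval_mul, Polynomial.eval_C, Lagrange.basis, Polynomial.eval_prod, jumpCoeff]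
  congr 1
  refine Finset.prod_congr rfl fun j _ => ?_
  rw [Lagrange.basisDivisor]
  simp only [Polynomial.eval_mul, Polynomial.eval_C, Polynomial.eval_sub, Polynomial.eval_X]
  rw [← neg_sub, inv_neg, zero_sub, neg_mul_neg, inv_mul_eq_div]

theorem prod_image_twenty_mul {s : Finset ℤ} (f : ℤ → ℝ) :
    ∏ j ∈ s.image (20 * ·), f j = ∏ j ∈ s, f (20 * j) :=
  Finset.prod_image (by intro a _ b _ h; simpa using h)

/-- Only the sign matters: the polynomial is nonpositive at `1`, so this node contributes nothing
positive, however large its coefficient. -/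
theorem jumpCoeff_one_nonneg (r : ℕ) : 0 ≤ jumpCoeff r 1 := by
  rw [jumpCoeff, jumpNodes, Finset.erase_insert (one_notMem r),
    Finset.prod_insert (neg_five_notMem r), prod_image_twenty_mul]
  refine mul_nonneg (by norm_num) (Finset.prod_nonneg fun j hj => ?_)
  have hj0 := (mem_puncturedIcc.1 hj).1
  push_cast
  rcases lt_or_gt_of_ne hj0 with h | h
  · have : (j : ℝ) ≤ -1 := by exact_mod_cast (show j ≤ -1 by omega)
    exact div_nonneg_of_nonpos (by linarith) (by linarith)
  · have : (1 : ℝ) ≤ j := by exact_mod_cast (show 1 ≤ j by omega)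
    exact div_nonneg (by linarith) (by linarith)

/-- The node `1` contributes `1/6` and the multiples of `20` contribute at most `4/3`. With `-1` in
place of `-5` the first factor would be `1/2`, which is too large. -/
theorem abs_jumpCoeff_neg_five_le (r : ℕ) : |jumpCoeff r (-5)| ≤ 2 / 9 := by
  have h : jumpCoeff r (-5) = 1 / 6 * ∏ j ∈ puncturedIcc r, (4 * j : ℝ) / (4 * j + 1) := by
    have h1 : (1 : ℤ) ∉ (puncturedIcc r).image (20 * ·) := fun h =>
      one_notMem r (Finset.mem_insert_of_mem h)
    rw [jumpCoeff, jumpNodes, Finset.erase_insert_of_ne (by norm_num),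
      Finset.erase_insert (neg_five_notMem r), Finset.prod_insert h1, prod_image_twenty_mul]
    congr 1
    · norm_num
    · refine Finset.prod_congr rfl fun j _ => ?_
      push_cast
      rw [show (20 * j : ℝ) = 5 * (4 * j) by ring,
        show (5 * (4 * j) - -5 : ℝ) = 5 * (4 * j + 1) by ring,
        mul_div_mul_left _ _ (by norm_num)]
  obtain ⟨h0, h1⟩ := prod_four_mul_div_puncturedIcc r
  have h2 : (4 * r + 3 : ℝ) / (3 * r + 3) ≤ 4 / 3 := by
    rw [div_le_div_iff₀ (by positivity) (by norm_num)]
    linarith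
  rw [h, abs_of_nonneg (mul_nonneg (by norm_num) h0)]
  linarith

/-- The nodes `1` and `-5` together supply the quadratic decay, through `5 / (|1 - 20k| |5 + 20k|) ≤
5 / (225 k^2)`; the other multiples of `20` contribute at most `1`. A single extra node would give
decay `1/|k|` only, which is not summable. -/
theorem abs_jumpCoeff_twenty_mul_le {r : ℕ} {k : ℤ} (hk : k ∈ puncturedIcc r) :
    |jumpCoeff r (20 * k)| ≤ 1 / 45 * (1 / (k : ℝ) ^ 2) := by
  have hk0 := (mem_puncturedIcc.1 hk).1
  have hset : (jumpNodes r).erase (20 * k) =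
      insert 1 (insert (-5) (((puncturedIcc r).erase k).image (20 * ·))) := by
    rw [jumpNodes, Finset.erase_insert_of_ne (by omega), Finset.erase_insert_of_ne (by omega),
      Finset.image_erase (mul_right_injective₀ (by norm_num))]
  have h1 : (1 : ℤ) ∉ insert (-5) (((puncturedIcc r).erase k).image (20 * ·)) := fun h =>
    one_notMem r (Finset.insert_subset_insert _ (Finset.image_subset_image
      (Finset.erase_subset _ _)) h)
  have h5 : (-5 : ℤ) ∉ ((puncturedIcc r).erase k).image (20 * ·) := fun h =>
    neg_five_notMem r (Finset.image_subset_image (Finset.erase_subset _ _) h)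
  rw [jumpCoeff, hset, Finset.prod_insert h1, Finset.prod_insert h5, prod_image_twenty_mul,
    abs_mul, abs_mul, ← mul_assoc]
  have hprod : |∏ j ∈ (puncturedIcc r).erase k,
      (((20 * j : ℤ) : ℝ) / ((20 * j : ℤ) - (20 * k : ℤ)))| ≤ 1 := by
    have e : ∀ j : ℤ, |((20 * j : ℤ) : ℝ) / ((20 * j : ℤ) - (20 * k : ℤ))| =
        |(j : ℝ)| / |(k : ℝ) - j| := by
      intro j
      push_cast
      rw [← mul_sub, mul_div_mul_left _ _ (by norm_num), abs_div, abs_sub_comm]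
    rw [Finset.abs_prod, Finset.prod_congr rfl fun j _ => e j, Finset.prod_div_distrib]
    exact div_le_one_of_le₀ prod_abs_le_prod_abs_sub
      (Finset.prod_nonneg fun _ _ => abs_nonneg _)
  refine (mul_le_of_le_one_right (by positivity) hprod).trans ?_
  push_cast
  have hk0' : (k : ℝ) ≠ 0 := by exact_mod_cast hk0
  have hb : 225 * (k : ℝ) ^ 2 ≤ |(1 - 20 * k : ℝ)| * |(-5 - 20 * k : ℝ)| := by
    rw [← abs_mul]
    refine le_trans ?_ (le_abs_self _)
    rcases lt_or_gt_of_ne hk0 with h | h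
    · have : (k : ℝ) ≤ -1 := by exact_mod_cast (show k ≤ -1 by omega)
      nlinarith
    · have : (1 : ℝ) ≤ k := by exact_mod_cast (show 1 ≤ k by omega)
      nlinarith
  have hk2 : 0 < (k : ℝ) ^ 2 := by positivity
  rw [abs_div, abs_div, div_mul_div_comm, div_mul_div_comm,
    div_le_div_iff₀ (by linarith) (by positivity)]
  norm_num
  linarith

/-- A polynomial of degree less than `2 r + 2` that is bounded by `1` on the integers of absolute
value at most `20 r`, and is not positive at `1`, is less than `1/3` at `0`. -/
theorem eval_zero_lt_of_natDegree_lt {r : ℕ} (hr : 1 ≤ r) {P : Polynomial ℝ}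
    (hP : P.natDegree < 2 * r + 2) (hb : ∀ z : ℤ, |z| ≤ 20 * r → |P.eval (z : ℝ)| ≤ 1)
    (h1 : P.eval 1 ≤ 0) : P.eval 0 < 1 / 3 := by
  rw [eval_zero_eq_sum_jumpCoeff hP, jumpNodes, Finset.sum_insert (one_notMem r),
    Finset.sum_insert (neg_five_notMem r),
    Finset.sum_image (by intro a _ b _ h; simpa using h)]
  have key : ∀ (z : ℤ) (c : ℝ), |z| ≤ 20 * r → |jumpCoeff r z| ≤ c →
      P.eval (z : ℝ) * jumpCoeff r z ≤ c := by
    intro z c hz hc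
    refine (le_abs_self _).trans ?_
    rw [abs_mul]
    exact (mul_le_of_le_one_left (abs_nonneg _) (hb z hz)).trans hc
  have e1 : P.eval ((1 : ℤ) : ℝ) * jumpCoeff r 1 ≤ 0 := by
    rw [Int.cast_one]
    exact mul_nonpos_of_nonpos_of_nonneg h1 (jumpCoeff_one_nonneg r)
  have e2 := key (-5) _ (by norm_num; omega) (abs_jumpCoeff_neg_five_le r)
  have e3 : ∑ j ∈ puncturedIcc r, P.eval ((20 * j : ℤ) : ℝ) * jumpCoeff r (20 * j) ≤
      ∑ j ∈ puncturedIcc r, 1 / 45 * (1 / (j : ℝ) ^ 2) := by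
    refine Finset.sum_le_sum fun j hj => key (20 * j) _ ?_ (abs_jumpCoeff_twenty_mul_le hj)
    have := (mem_puncturedIcc.1 hj).2
    rw [abs_mul]
    norm_num
    exact this
  rw [← Finset.mul_sum] at e3
  have e4 := sum_inv_sq_puncturedIcc_le r
  have e5 : (0 : ℝ) < 4 / (2 * r + 1) := by positivity
  -- The total is below `0 + 2/9 + 4/45 = 14/45 < 1/3`.
  refine (add_le_add e1 (add_le_add e2 e3)).trans_lt ?_
  linarith

/-! ### Functions of bounded degree on the hypercube -/

/-- The indicator function of the event that all coordinates in `S` are `-1`. -/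
noncomputable def allNeg {n : ℕ} (S : Finset (Fin n)) : Cube n → ℝ :=
  fun x => if ∀ i ∈ S, x i = -1 then 1 else 0

/-- The functions of degree at most `d` on the hypercube. -/
noncomputable def degreeLE (n d : ℕ) : Submodule ℝ (Cube n → ℝ) :=
  Submodule.span ℝ (allNeg '' {S | S.card ≤ d})

theorem allNeg_mem_degreeLE {n d : ℕ} {S : Finset (Fin n)} (h : S.card ≤ d) :
    allNeg S ∈ degreeLE n d :=
  Submodule.subset_span ⟨S, h, rfl⟩

theorem degreeLE_mono {n a b : ℕ} (h : a ≤ b) : degreeLE n a ≤ degreeLE n b :=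
  Submodule.span_mono (Set.image_mono fun _ hS => le_trans hS h)

theorem allNeg_mul {n : ℕ} (S S' : Finset (Fin n)) : allNeg S * allNeg S' = allNeg (S ∪ S') := by
  funext x
  simp only [allNeg, Pi.mul_apply, Finset.mem_union]
  split_ifs <;> grind

theorem mul_mem_degreeLE {n a b : ℕ} {f g : Cube n → ℝ} (hf : f ∈ degreeLE n a)
    (hg : g ∈ degreeLE n b) : f * g ∈ degreeLE n (a + b) := by
  have h : degreeLE n a * degreeLE n b ≤ degreeLE n (a + b) := by
    rw [degreeLE, degreeLE, Submodule.span_mul_span, Submodule.span_le]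
    rintro _ ⟨_, ⟨S, hS, rfl⟩, _, ⟨S', hS', rfl⟩, rfl⟩
    simp only [allNeg_mul]
    exact allNeg_mem_degreeLE ((Finset.card_union_le _ _).trans (add_le_add hS hS'))
  exact h (Submodule.mul_mem_mul hf hg)

theorem const_mem_degreeLE {n : ℕ} (c : ℝ) (d : ℕ) : (fun _ => c) ∈ degreeLE n d := by
  have h : (fun _ => c : Cube n → ℝ) = c • allNeg ∅ := by
    funext x
    simp [allNeg]
  rw [h]
  exact Submodule.smul_mem _ _ (allNeg_mem_degreeLE (by simp))

theorem coord_mem_degreeLE {n : ℕ} (i : Fin n) : (fun x => toReal (x i)) ∈ degreeLE n 1 := by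
  have h : (fun x => toReal (x i) : Cube n → ℝ) = (fun _ => 1) - (2 : ℝ) • allNeg {i} := by
    funext x
    rcases Int.units_eq_one_or (x i) with h | h <;> norm_num [allNeg, toReal, h]
  rw [h]
  exact Submodule.sub_mem _ (const_mem_degreeLE _ _)
    (Submodule.smul_mem _ _ (allNeg_mem_degreeLE (by simp)))

theorem pow_mem_degreeLE {n a : ℕ} {f : Cube n → ℝ} (hf : f ∈ degreeLE n a) (k : ℕ) :
    f ^ k ∈ degreeLE n (k * a) := by
  induction k with
  | zero => simpa using! const_mem_degreeLE 1 0
  | succ k ih => rw [pow_succ, add_mul, one_mul]; exact mul_mem_degreeLE ih hf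

theorem prod_mem_degreeLE {n : ℕ} {ι : Type*} (s : Finset ι) (f : ι → Cube n → ℝ) (a : ι → ℕ)
    (h : ∀ i ∈ s, f i ∈ degreeLE n (a i)) : ∏ i ∈ s, f i ∈ degreeLE n (∑ i ∈ s, a i) := by
  classical
  induction s using Finset.induction_on with
  | empty => simpa using! const_mem_degreeLE 1 0
  | insert i s hi ih =>
    rw [Finset.prod_insert hi, Finset.sum_insert hi]
    exact mul_mem_degreeLE (h i (Finset.mem_insert_self _ _))
      (ih fun j hj => h j (Finset.mem_insert_of_mem hj))

theorem evalCube_mem_degreeLE {n : ℕ} (p : MvPolynomial (Fin n) ℝ) :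
    evalCube p ∈ degreeLE n p.totalDegree := by
  have h : evalCube p = ∑ e ∈ p.support,
      p.coeff e • ∏ i ∈ e.support, (fun x : Cube n => toReal (x i)) ^ e i := by
    funext x
    simp [evalCube, MvPolynomial.eval_eq, Finset.sum_apply]
  rw [h]
  refine Submodule.sum_mem _ fun e he => Submodule.smul_mem _ _ ?_
  refine degreeLE_mono (MvPolynomial.le_totalDegree he) ?_
  refine prod_mem_degreeLE _ _ _ fun i _ => ?_
  simpa using pow_mem_degreeLE (coord_mem_degreeLE i) (e i)

/-! ### Symmetrization -/

/-- The point of the hypercube whose coordinates in `A` are `-1`, and whose other coordinates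
are `1`. -/
noncomputable def cubePoint {n : ℕ} (A : Finset (Fin n)) : Cube n := fun i => if i ∈ A then -1 else 1

theorem cubePoint_eq_neg_one {n : ℕ} {A : Finset (Fin n)} {i : Fin n} :
    cubePoint A i = -1 ↔ i ∈ A := by
  unfold cubePoint
  split_ifs with h <;> simp [h]

theorem allNeg_cubePoint {n : ℕ} (S A : Finset (Fin n)) :
    allNeg S (cubePoint A) = if S ⊆ A then 1 else 0 := by
  simp only [allNeg, cubePoint_eq_neg_one, Finset.subset_iff]

theorem sdiff_subset_iff_subset_union {α : Type*} [DecidableEq α] {S A B : Finset α} :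
    S \ B ⊆ A ↔ S ⊆ A ∪ B := by
  rw [Finset.union_comm]
  exact sdiff_le_iff

/-- Averaging a function of degree at most `d` over the points with `k` coordinates equal to `-1` in
`L`, and with the coordinates outside `L` fixed, gives a polynomial in `k` of degree at most `d`. -/
theorem exists_polynomial_sum_powersetCard {n d : ℕ} (L B : Finset (Fin n)) {g : Cube n → ℝ}
    (hg : g ∈ degreeLE n d) : ∃ P : Polynomial ℝ, P.natDegree ≤ d ∧ ∀ k : ℕ,
      ∑ A ∈ L.powersetCard k, g (cubePoint (A ∪ B)) = (L.card.choose k) * P.eval (k : ℝ) := by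
  induction hg using Submodule.span_induction with
  | mem g hg =>
    obtain ⟨S, hS, rfl⟩ := hg
    by_cases hSL : S \ B ⊆ L
    · set s := (S \ B).card
      -- The sum counts the `k`-subsets of `L` that contain `S \ B`. With `ℓ = |L|` this is `C(ℓ-s,
      -- k-s) = C(ℓ,k) C(k,s) / C(ℓ,s)`, and `C(k,s)` is the falling factorial of `k` over `s!`.
      refine ⟨Polynomial.C (((s.factorial * L.card.choose s : ℕ) : ℝ)⁻¹) * descPochhammer ℝ s,
        (Polynomial.natDegree_C_mul_le _ _).trans ?_, fun k => ?_⟩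
      · rw [descPochhammer_natDegree]
        exact (Finset.card_le_card Finset.sdiff_subset).trans hS
      · have h1 : ∀ A, allNeg S (cubePoint (A ∪ B)) = if S \ B ⊆ A then 1 else 0 := by
          intro A
          simp only [allNeg_cubePoint, sdiff_subset_iff_subset_union]
        simp only [h1, Finset.sum_boole]
        rw [Polynomial.eval_mul, Polynomial.eval_C, descPochhammer_eval_eq_descFactorial,
          Nat.descFactorial_eq_factorial_mul_choose]
        have hs0 : (s.factorial : ℝ) ≠ 0 := by exact_mod_cast s.factorial_ne_zero
        have hc0 : (L.card.choose s : ℝ) ≠ 0 := by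
          exact_mod_cast (Nat.choose_pos (Finset.card_le_card hSL)).ne'
        rcases le_or_gt s k with hsk | hsk
        · rw [Finset.card_filter_powersetCard_subset _ _ _ hSL hsk]
          have h := Nat.choose_mul (n := L.card) hsk
          have h' : (L.card.choose k : ℝ) * k.choose s =
            L.card.choose s * (L.card - s).choose (k - s) := by exact_mod_cast h
          push_cast
          field_simp
          linarith
        -- For `k < s` truncated subtraction spoils the identity, but both sides vanish.
        · rw [Nat.choose_eq_zero_of_lt hsk, Finset.filter_false_of_mem]
          · simp
          · intro A hA h
            have := Finset.card_le_card h
            rw [(Finset.mem_powersetCard.1 hA).2] at this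
            omega
    · refine ⟨0, by simp, fun k => ?_⟩
      rw [Polynomial.eval_zero, mul_zero]
      refine Finset.sum_eq_zero fun A hA => ?_
      rw [allNeg_cubePoint, if_neg]
      intro h
      rw [← sdiff_subset_iff_subset_union] at h
      exact hSL (h.trans (Finset.mem_powersetCard.1 hA).1)
  | zero => exact ⟨0, by simp, by simp⟩
  | add f g _ _ hf hg =>
    obtain ⟨P, hP, hP'⟩ := hf
    obtain ⟨Q, hQ, hQ'⟩ := hg
    refine ⟨P + Q, Polynomial.natDegree_add_le_of_degree_le hP hQ, fun k => ?_⟩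
    simp only [Pi.add_apply, Finset.sum_add_distrib, hP', hQ', Polynomial.eval_add, mul_add]
  | smul c g _ hg =>
    obtain ⟨P, hP, hP'⟩ := hg
    refine ⟨Polynomial.C c * P, (Polynomial.natDegree_C_mul_le _ _).trans hP, fun k => ?_⟩
    simp only [Pi.smul_apply, smul_eq_mul, ← Finset.mul_sum, hP', Polynomial.eval_mul,
      Polynomial.eval_C]
    ring

theorem partWeight_cubePoint {n : ℕ} (s A : Finset (Fin n)) :
    partWeight s (cubePoint A) = (s ∩ A).card := by
  simp only [partWeight, cubePoint_eq_neg_one, Finset.filter_mem_eq_inter]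

theorem disjoint_leftHalf_rightHalf (m : ℕ) : Disjoint (leftHalf m) (rightHalf m) := by
  rw [leftHalf, rightHalf, Finset.disjoint_filter]
  intros
  omega

/-- A function on the hypercube that is bounded by `1`, at least `1/3` on `sPlus` and at most
`-1/3` on `sMinus` has degree at least `n / 82`. -/
theorem le_of_mem_degreeLE {m d : ℕ} {g : Cube (4 * m + 2) → ℝ}
    (hg : g ∈ degreeLE (4 * m + 2) d) (hb : ∀ x, |g x| ≤ 1) (hp : ∀ x ∈ sPlus m, 1 / 3 ≤ g x)
    (hn : ∀ x ∈ sMinus m, g x ≤ -(1 / 3)) : 4 * m + 2 ≤ 82 * d := by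
  obtain ⟨B, hBR, hB⟩ := Finset.exists_subset_card_eq
    (show m ≤ (rightHalf m).card by rw [card_rightHalf]; omega)
  obtain ⟨P, hPd, hP⟩ := exists_polynomial_sum_powersetCard (leftHalf m) B hg
  rw [card_leftHalf] at hP
  have hdis := disjoint_leftHalf_rightHalf m
  have hwL : ∀ k, ∀ A ∈ (leftHalf m).powersetCard k,
      partWeight (leftHalf m) (cubePoint (A ∪ B)) = k := by
    intro k A hA
    obtain ⟨hA, hk⟩ := Finset.mem_powersetCard.1 hA
    rw [partWeight_cubePoint, Finset.inter_union_distrib_left, Finset.inter_eq_right.2 hA,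
      Finset.disjoint_iff_inter_eq_empty.1 (hdis.mono_right hBR), Finset.union_empty, hk]
  have hwR : ∀ k, ∀ A ∈ (leftHalf m).powersetCard k,
      partWeight (rightHalf m) (cubePoint (A ∪ B)) = m := by
    intro k A hA
    obtain ⟨hA, hk⟩ := Finset.mem_powersetCard.1 hA
    rw [partWeight_cubePoint, Finset.inter_union_distrib_left, Finset.inter_eq_right.2 hBR,
      Finset.disjoint_iff_inter_eq_empty.1 (hdis.symm.mono_right hA), Finset.empty_union, hB]
  have hpos : ∀ k ≤ 2 * m + 1, (0 : ℝ) < (2 * m + 1).choose k := fun k hk => by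
    exact_mod_cast Nat.choose_pos hk
  have hcard : ∀ k c, ∑ _A ∈ (leftHalf m).powersetCard k, c = ((2 * m + 1).choose k : ℝ) * c := by
    intro k c
    rw [Finset.sum_const, Finset.card_powersetCard, card_leftHalf, nsmul_eq_mul]
  have hPb : ∀ k : ℕ, k ≤ 2 * m + 1 → |P.eval (k : ℝ)| ≤ 1 := by
    intro k hk
    refine le_of_mul_le_mul_left ?_ (hpos k hk)
    rw [← abs_of_pos (hpos k hk), ← abs_mul, ← hP, abs_of_pos (hpos k hk), ← hcard]
    exact (Finset.abs_sum_le_sum_abs _ _).trans (Finset.sum_le_sum fun A _ => hb _)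
  have hPp : 1 / 3 ≤ P.eval (m : ℝ) := by
    refine le_of_mul_le_mul_left ?_ (hpos m (by omega))
    rw [← hP, ← hcard]
    exact Finset.sum_le_sum fun A hA => hp _ ⟨hwL _ A hA, hwR _ A hA⟩
  have hPn : P.eval ((m : ℝ) + 1) ≤ -(1 / 3) := by
    rw [← Nat.cast_succ]
    refine le_of_mul_le_mul_left ?_ (hpos (m + 1) (by omega))
    rw [← hP, ← hcard]
    refine Finset.sum_le_sum fun A hA => hn _ ?_
    simp only [sMinus, Set.mem_ofPred_eq, hwL _ A hA, hwR _ A hA]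
    omega
  rcases Nat.eq_zero_or_pos (m / 20) with hr | hr
  -- For `m < 20` it is enough that `P` is not constant, since then `4m+2 ≤ 78`.
  · rcases Nat.eq_zero_or_pos d with hd | hd
    · rw [hd, Nat.le_zero] at hPd
      rw [Polynomial.eq_C_of_natDegree_eq_zero hPd, Polynomial.eval_C] at hPp hPn
      linarith
    · omega
  · set r := m / 20
    by_contra hlt
    have hP' : (P.comp (Polynomial.X + Polynomial.C (m : ℝ))).natDegree < 2 * r + 2 := by
      rw [Polynomial.natDegree_comp, Polynomial.natDegree_X_add_C]
      omega
    have := eval_zero_lt_of_natDegree_lt hr hP' (fun z hz => ?_) ?_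
    · simp at this
      linarith
    -- `|z| ≤ 20r ≤ m` places `z + m` in `[0, 2m]`, where `P` is an average of values of `g`.
    · have hz' : ((z + m).toNat : ℤ) = z + m := Int.toNat_of_nonneg (by rw [abs_le] at hz; omega)
      have := hPb (z + m).toNat (by rw [abs_le] at hz; omega)
      rw [← Int.cast_natCast, hz'] at this
      simpa using this
    · simp only [Polynomial.eval_comp, Polynomial.eval_add, Polynomial.eval_X, Polynomial.eval_C]
      rw [add_comm]
      linarith

theorem le_totalDegree_of_approximates {m : ℕ} {p : MvPolynomial (Fin (4 * m + 2)) ℝ}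
    (hp : Approximates (1 / 3) p (boolImbalance m)) : 4 * m + 2 ≤ 82 * p.totalDegree := by
  refine le_of_mem_degreeLE (evalCube_mem_degreeLE p) hp.2 (fun x hx => ?_) fun x hx => ?_
  · have h : |evalCube p x - imbalance m x| ≤ 1 / 3 := hp.1 ⟨x, Or.inr hx⟩
    rw [imbalance_of_mem_sPlus hx, abs_le] at h
    linarith
  · have h : |evalCube p x - imbalance m x| ≤ 1 / 3 := hp.1 ⟨x, Or.inl hx⟩
    rw [imbalance_of_mem_sMinus hx, abs_le] at h
    linarith

/-! ### The polynomial method for quantum query algorithms -/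

/-- Each new amplitude is affine in a single input coordinate, so a query raises the degree by at
most one. -/
theorem applyQuery_eq {n k : ℕ} (x : Cube n) (ψ : RegisterState n k) (v : RegisterBasis n k) :
    applyQuery x ψ v = (((1 + toReal (x v.2.2.1)) / 2 : ℝ) : ℂ) * ψ v +
      (((1 - toReal (x v.2.2.1)) / 2 : ℝ) : ℂ) *
        ψ (v.1, v.2.1, v.2.2.1, v.2.2.2.1 * -1, v.2.2.2.2) := by
  unfold applyQuery
  rcases Int.units_eq_one_or (x v.2.2.1) with h | h <;> rw [h] <;> norm_num [toReal]

theorem re_mem_im_mem_degreeLE_mulVec {n d : ℕ} {ι : Type*} [Fintype ι] (U : Matrix ι ι ℂ)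
    {ψ : Cube n → ι → ℂ}
    (h : ∀ v, (fun x => (ψ x v).re) ∈ degreeLE n d ∧ (fun x => (ψ x v).im) ∈ degreeLE n d) (v : ι) :
    (fun x => (U.mulVec (ψ x) v).re) ∈ degreeLE n d ∧
      (fun x => (U.mulVec (ψ x) v).im) ∈ degreeLE n d := by
  have hre : (fun x => (U.mulVec (ψ x) v).re) =
      ∑ w, ((U v w).re • (fun x => (ψ x w).re) - (U v w).im • fun x => (ψ x w).im) := by
    funext x
    simp [Matrix.mulVec, dotProduct, Complex.mul_re]
  have him : (fun x => (U.mulVec (ψ x) v).im) =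
      ∑ w, ((U v w).re • (fun x => (ψ x w).im) + (U v w).im • fun x => (ψ x w).re) := by
    funext x
    simp [Matrix.mulVec, dotProduct, Complex.mul_im]
  rw [hre, him]
  exact ⟨Submodule.sum_mem _ fun w _ => Submodule.sub_mem _ (Submodule.smul_mem _ _ (h w).1)
      (Submodule.smul_mem _ _ (h w).2),
    Submodule.sum_mem _ fun w _ => Submodule.add_mem _ (Submodule.smul_mem _ _ (h w).2)
      (Submodule.smul_mem _ _ (h w).1)⟩

theorem re_mem_im_mem_degreeLE_applyQuery {n k d : ℕ} {ψ : Cube n → RegisterState n k}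
    (h : ∀ v, (fun x => (ψ x v).re) ∈ degreeLE n d ∧ (fun x => (ψ x v).im) ∈ degreeLE n d)
    (v : RegisterBasis n k) :
    (fun x => (applyQuery x (ψ x) v).re) ∈ degreeLE n (d + 1) ∧
      (fun x => (applyQuery x (ψ x) v).im) ∈ degreeLE n (d + 1) := by
  have hp : (fun x : Cube n => (1 + toReal (x v.2.2.1)) / 2) ∈ degreeLE n 1 := by
    have e : (fun x : Cube n => (1 + toReal (x v.2.2.1)) / 2) =
        (fun _ => 1 / 2) + (1 / 2 : ℝ) • fun x => toReal (x v.2.2.1) := by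
      funext x
      simp only [Pi.add_apply, Pi.smul_apply, smul_eq_mul]
      ring
    rw [e]
    exact Submodule.add_mem _ (const_mem_degreeLE _ _)
      (Submodule.smul_mem _ _ (coord_mem_degreeLE _))
  have hm : (fun x : Cube n => (1 - toReal (x v.2.2.1)) / 2) ∈ degreeLE n 1 := by
    have e : (fun x : Cube n => (1 - toReal (x v.2.2.1)) / 2) =
        (fun _ => 1) - fun x => (1 + toReal (x v.2.2.1)) / 2 := by
      funext x
      simp only [Pi.sub_apply]
      ring
    rw [e]
    exact Submodule.sub_mem _ (const_mem_degreeLE _ _) hp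
  set w : RegisterBasis n k := (v.1, v.2.1, v.2.2.1, v.2.2.2.1 * -1, v.2.2.2.2)
  have hre : (fun x => (applyQuery x (ψ x) v).re) =
      (fun x => (ψ x v).re) * (fun x => (1 + toReal (x v.2.2.1)) / 2) +
        (fun x => (ψ x w).re) * (fun x => (1 - toReal (x v.2.2.1)) / 2) := by
    funext x
    rw [applyQuery_eq, Complex.add_re, Complex.re_ofReal_mul, Complex.re_ofReal_mul]
    simp only [Pi.add_apply, Pi.mul_apply]
    ring
  have him : (fun x => (applyQuery x (ψ x) v).im) =
      (fun x => (ψ x v).im) * (fun x => (1 + toReal (x v.2.2.1)) / 2) +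
        (fun x => (ψ x w).im) * (fun x => (1 - toReal (x v.2.2.1)) / 2) := by
    funext x
    rw [applyQuery_eq, Complex.add_im, Complex.im_ofReal_mul, Complex.im_ofReal_mul]
    simp only [Pi.add_apply, Pi.mul_apply]
    ring
  rw [hre, him]
  exact ⟨Submodule.add_mem _ (mul_mem_degreeLE (h v).1 hp) (mul_mem_degreeLE (h w).1 hm),
    Submodule.add_mem _ (mul_mem_degreeLE (h v).2 hp) (mul_mem_degreeLE (h w).2 hm)⟩

/-- The amplitudes after `t` queries have degree at most `t`. -/
theorem re_mem_im_mem_degreeLE_stateAfter {n T : ℕ} (A : QueryAlgorithm n T) :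
    ∀ (t : ℕ) (ht : t ≤ T) (v : RegisterBasis n A.ancillas),
      (fun x => (A.stateAfter x t ht v).re) ∈ degreeLE n t ∧
        (fun x => (A.stateAfter x t ht v).im) ∈ degreeLE n t
  | 0, _, v => ⟨const_mem_degreeLE ((A.unitary 0).1.mulVec (Pi.single A.init 1) v).re 0,
      const_mem_degreeLE ((A.unitary 0).1.mulVec (Pi.single A.init 1) v).im 0⟩
  | t + 1, ht, v => re_mem_im_mem_degreeLE_mulVec _
      (re_mem_im_mem_degreeLE_applyQuery
        (re_mem_im_mem_degreeLE_stateAfter A t (Nat.le_of_succ_le ht))) v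

theorem prob_mem_degreeLE {n T : ℕ} (A : QueryAlgorithm n T)
    (E : Set (RegisterBasis n A.ancillas)) : (fun x => A.prob x E) ∈ degreeLE n (2 * T) := by
  classical
  have h : (fun x => A.prob x E) = ∑ v, if v ∈ E then
      (fun x => (A.finalState x v).re) * (fun x => (A.finalState x v).re) +
        (fun x => (A.finalState x v).im) * (fun x => (A.finalState x v).im) else 0 := by
    funext x
    rw [QueryAlgorithm.prob, Finset.sum_apply]
    refine Finset.sum_congr rfl fun v _ => ?_
    split_ifs
    · rw [Complex.sq_norm, Complex.normSq_apply]
      rfl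
    · rfl
  rw [h]
  refine Submodule.sum_mem _ fun v _ => ?_
  obtain ⟨hre, him⟩ := re_mem_im_mem_degreeLE_stateAfter A T le_rfl v
  split_ifs
  · rw [two_mul]
    exact Submodule.add_mem _ (mul_mem_degreeLE hre hre) (mul_mem_degreeLE him him)
  · exact Submodule.zero_mem _

/-! ### Conservation of norm and the bound for quantum queries -/

theorem sum_norm_sq_mulVec {ι : Type*} [Fintype ι] [DecidableEq ι]
    (U : Matrix.unitaryGroup ι ℂ) (ψ : ι → ℂ) :
    ∑ v, ‖U.1.mulVec ψ v‖ ^ 2 = ∑ v, ‖ψ v‖ ^ 2 := by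
  have e : ∀ φ : ι → ℂ, ((∑ v, ‖φ v‖ ^ 2 : ℝ) : ℂ) = star φ ⬝ᵥ φ := by
    intro φ
    simp [dotProduct, Complex.conj_mul']
  apply Complex.ofReal_injective
  rw [e, e, Matrix.star_mulVec, Matrix.dotProduct_mulVec, Matrix.vecMul_vecMul,
    ← Matrix.star_eq_conjTranspose, Matrix.mem_unitaryGroup_iff'.1 U.2, Matrix.vecMul_one]

theorem sum_norm_sq_applyQuery {n k : ℕ} (x : Cube n) (ψ : RegisterState n k) :
    ∑ v, ‖applyQuery x ψ v‖ ^ 2 = ∑ v, ‖ψ v‖ ^ 2 := by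
  have h : Function.Involutive (fun v : RegisterBasis n k =>
      ((v.1, v.2.1, v.2.2.1, v.2.2.2.1 * x v.2.2.1, v.2.2.2.2) : RegisterBasis n k)) := by
    intro v
    simp [mul_assoc, Int.units_mul_self]
  exact Equiv.sum_comp h.toPerm (fun v => ‖ψ v‖ ^ 2)

theorem sum_norm_sq_stateAfter {n T : ℕ} (A : QueryAlgorithm n T) (x : Cube n) :
    ∀ (t : ℕ) (ht : t ≤ T), ∑ v, ‖A.stateAfter x t ht v‖ ^ 2 = 1
  | 0, _ => by
    rw [QueryAlgorithm.stateAfter, sum_norm_sq_mulVec, Finset.sum_eq_single A.init]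
    · simp
    · intro v _ hv
      simp [hv]
    · simp
  | t + 1, ht => by
    rw [QueryAlgorithm.stateAfter, sum_norm_sq_mulVec, sum_norm_sq_applyQuery,
      sum_norm_sq_stateAfter A x t]

theorem prob_nonneg {n T : ℕ} (A : QueryAlgorithm n T) (x : Cube n)
    (E : Set (RegisterBasis n A.ancillas)) : 0 ≤ A.prob x E := by
  unfold QueryAlgorithm.prob
  exact Finset.sum_nonneg fun v _ => by split_ifs <;> positivity

/-- This holds on the whole cube, so the acceptance probability stays in `[0, 1]` off the domain
too, as symmetrization requires. -/
theorem prob_output_add {n T : ℕ} (A : QueryAlgorithm n T) (x : Cube n) :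
    A.prob x {v | toReal v.1 = 1} + A.prob x {v | toReal v.1 = -1} = 1 := by
  rw [QueryAlgorithm.prob, QueryAlgorithm.prob, ← Finset.sum_add_distrib]
  refine Eq.trans ?_ (sum_norm_sq_stateAfter A x T le_rfl)
  refine Finset.sum_congr rfl fun v _ => ?_
  rcases Int.units_eq_one_or v.1 with h | h <;>
    norm_num [h, toReal, QueryAlgorithm.finalState]

theorem le_of_computes {m T : ℕ} {A : QueryAlgorithm (4 * m + 2) T}
    (hA : A.Computes (1 / 3) (boolImbalance m)) : 4 * m + 2 ≤ 164 * T := by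
  -- The rescaling sends probabilities `2/3` and `1/3` to `1/3` and `-1/3`; degree `2T` turns the
  -- constant `82` into `164`.
  have hg : (fun x => 2 * A.prob x {v | toReal v.1 = 1} - 1) ∈
      degreeLE (4 * m + 2) (2 * T) :=
    Submodule.sub_mem _ (Submodule.smul_mem _ (2 : ℝ) (prob_mem_degreeLE A _))
      (const_mem_degreeLE _ _)
  have h := le_of_mem_degreeLE hg (fun x => ?_) (fun x hx => ?_) (fun x hx => ?_)
  · omega
  · have h1 := prob_nonneg A x {v | toReal v.1 = 1}
    have h2 := prob_nonneg A x {v | toReal v.1 = -1}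
    have h3 := prob_output_add A x
    rw [abs_le]
    constructor <;> linarith
  · have h : 1 - 1 / 3 ≤ A.prob x {v | toReal v.1 = imbalance m x} := hA ⟨x, Or.inr hx⟩
    rw [imbalance_of_mem_sPlus hx] at h
    linarith
  · have h : 1 - 1 / 3 ≤ A.prob x {v | toReal v.1 = imbalance m x} := hA ⟨x, Or.inl hx⟩
    rw [imbalance_of_mem_sMinus hx] at h
    have h3 := prob_output_add A x
    linarith

/-! ### The post-selected algorithm -/

/-- The product of the reflections in two real vectors, for orthogonal vectors of squared
length `2`. -/
def doubleReflection {ι : Type*} [DecidableEq ι] (v w : ι → ℂ) : Matrix ι ι ℂ :=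
  1 - Matrix.vecMulVec v v - Matrix.vecMulVec w w

/-- Real entries make the matrix Hermitian. It squares to `1`: each cross term with itself gives `2
v vᵀ`, which cancels the `-2 v vᵀ`, and orthogonality removes the mixed terms. -/
theorem doubleReflection_mem_unitaryGroup {ι : Type*} [Fintype ι] [DecidableEq ι] {v w : ι → ℂ}
    (hv : star v = v) (hw : star w = w) (hvv : v ⬝ᵥ v = 2) (hww : w ⬝ᵥ w = 2) (hvw : v ⬝ᵥ w = 0) :
    doubleReflection v w ∈ Matrix.unitaryGroup ι ℂ := by
  have hwv : w ⬝ᵥ v = 0 := by rw [dotProduct_comm, hvw]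
  have hs : star (doubleReflection v w) = doubleReflection v w := by
    rw [doubleReflection, star_sub, star_sub, star_one, Matrix.star_eq_conjTranspose,
      Matrix.star_eq_conjTranspose, Matrix.conjTranspose_vecMulVec, Matrix.conjTranspose_vecMulVec,
      hv, hw]
  rw [Matrix.mem_unitaryGroup_iff, hs, doubleReflection]
  simp only [sub_mul, mul_sub, one_mul, mul_one, Matrix.vecMulVec_mul_vecMulVec, hvv, hww, hvw,
    hwv, zero_smul, Matrix.vecMulVec_smul, Matrix.vecMulVec_zero]
  module

theorem doubleReflection_mulVec {ι : Type*} [Fintype ι] [DecidableEq ι] (v w ψ : ι → ℂ) :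
    (doubleReflection v w).mulVec ψ = ψ - (v ⬝ᵥ ψ) • v - (w ⬝ᵥ ψ) • w := by
  simp only [doubleReflection, Matrix.sub_mulVec, Matrix.one_mulVec, Matrix.vecMulVec_mulVec]
  simp

/-- The state `∑ i, c i |1⟩|false⟩|i⟩|1⟩`. -/
def indexState {n : ℕ} (c : Fin n → ℂ) : RegisterState n 0 :=
  fun v => if v.1 = 1 ∧ v.2.1 = false ∧ v.2.2.2.1 = 1 then c v.2.2.1 else 0

/-- The basis state `|a⟩|true⟩|0⟩|1⟩`. -/
def flagBasis (m : ℕ) (a : ℤˣ) : RegisterBasis (4 * m + 2) 0 := (a, true, 0, 1, fun _ => false)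

theorem indexState_dotProduct_indexState {n : ℕ} (c d : Fin n → ℂ) :
    indexState c ⬝ᵥ indexState d = c ⬝ᵥ d := by
  simp [dotProduct, indexState, Fintype.sum_prod_type, ite_and]

theorem indexState_flagBasis {m : ℕ} (c : Fin (4 * m + 2) → ℂ) (a : ℤˣ) :
    indexState c (flagBasis m a) = 0 := by
  simp [indexState, flagBasis]

theorem flagBasis_injective (m : ℕ) : Function.Injective (flagBasis m) := fun _ _ h =>
  congrArg Prod.fst h

theorem star_indexState {n : ℕ} {c : Fin n → ℂ} (h : star c = c) :
    star (indexState c) = indexState c := by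
  funext v
  have := congrFun h v.2.2.1
  simp only [Pi.star_apply, indexState] at this ⊢
  split_ifs
  · exact this
  · exact star_zero _

theorem star_single_one {ι : Type*} [DecidableEq ι] (i : ι) :
    star (Pi.single i 1 : ι → ℂ) = Pi.single i 1 := by
  rw [← Pi.single_star, star_one]

/-- The vector `(c, -1)` of the algorithm: the weighted superposition of all indices minus the flag
state for the output `a`. -/
def flagVector {m : ℕ} (c : Fin (4 * m + 2) → ℂ) (a : ℤˣ) : RegisterState (4 * m + 2) 0 :=
  indexState c - Pi.single (flagBasis m a) 1

theorem star_flagVector {m : ℕ} {c : Fin (4 * m + 2) → ℂ} (h : star c = c) (a : ℤˣ) :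
    star (flagVector c a) = flagVector c a := by
  rw [flagVector, star_sub, star_indexState h, star_single_one]

theorem flagVector_dotProduct_indexState {m : ℕ} (c d : Fin (4 * m + 2) → ℂ) (a : ℤˣ) :
    flagVector c a ⬝ᵥ indexState d = c ⬝ᵥ d := by
  simp [flagVector, sub_dotProduct, indexState_dotProduct_indexState, indexState_flagBasis]

theorem flagVector_dotProduct_single {m : ℕ} (c : Fin (4 * m + 2) → ℂ) (a b : ℤˣ) :
    flagVector c a ⬝ᵥ Pi.single (flagBasis m b) 1 = if a = b then -1 else 0 := by
  rw [dotProduct_single, mul_one, flagVector, Pi.sub_apply, indexState_flagBasis, zero_sub]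
  split_ifs with h
  · rw [h, Pi.single_eq_same]
  · rw [Pi.single_eq_of_ne ((flagBasis_injective m).ne (Ne.symm h)), neg_zero]

theorem flagVector_dotProduct_flagVector {m : ℕ} (c d : Fin (4 * m + 2) → ℂ) (a b : ℤˣ) :
    flagVector c a ⬝ᵥ flagVector d b = c ⬝ᵥ d + if a = b then 1 else 0 := by
  conv_lhs => rw [show flagVector d b = indexState d - Pi.single (flagBasis m b) 1 from rfl]
  rw [dotProduct_sub, flagVector_dotProduct_indexState, flagVector_dotProduct_single]
  split_ifs <;> ring

/-- The uniform amplitudes. -/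
noncomputable def uniformAmp (m : ℕ) : Fin (4 * m + 2) → ℂ :=
  fun _ => ((Real.sqrt (4 * m + 2))⁻¹ : ℝ)

/-- The amplitudes with sign `1` on the left half and `-1` on the right half. -/
noncomputable def signedAmp (m : ℕ) : Fin (4 * m + 2) → ℂ :=
  fun i => (((if i ∈ leftHalf m then 1 else -1) * (Real.sqrt (4 * m + 2))⁻¹ : ℝ) : ℂ)

theorem star_uniformAmp (m : ℕ) : star (uniformAmp m) = uniformAmp m := by
  funext i
  simp [uniformAmp]

theorem star_signedAmp (m : ℕ) : star (signedAmp m) = signedAmp m := by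
  funext i
  exact Complex.conj_ofReal _

theorem leftHalf_union_rightHalf (m : ℕ) : leftHalf m ∪ rightHalf m = Finset.univ := by
  ext i
  simp only [leftHalf, rightHalf, Finset.mem_union, Finset.mem_filter, Finset.mem_univ, true_and,
    iff_true]
  omega

theorem sum_eq_sum_leftHalf_add {M : Type*} [AddCommMonoid M] {m : ℕ} (f : Fin (4 * m + 2) → M) :
    ∑ i, f i = ∑ i ∈ leftHalf m, f i + ∑ i ∈ rightHalf m, f i := by
  rw [← leftHalf_union_rightHalf m, Finset.sum_union (disjoint_leftHalf_rightHalf m)]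

theorem inv_sqrt_mul_self (m : ℕ) :
    (Real.sqrt (4 * m + 2))⁻¹ * (Real.sqrt (4 * m + 2))⁻¹ = (4 * m + 2 : ℝ)⁻¹ := by
  rw [← mul_inv, Real.mul_self_sqrt (by positivity)]

theorem uniformAmp_dotProduct (m : ℕ) (f : Fin (4 * m + 2) → ℝ) :
    uniformAmp m ⬝ᵥ (fun i => (f i : ℂ) * uniformAmp m i) =
      (((∑ i ∈ leftHalf m, f i + ∑ i ∈ rightHalf m, f i) * (4 * m + 2 : ℝ)⁻¹ : ℝ) : ℂ) := by
  rw [← sum_eq_sum_leftHalf_add, ← inv_sqrt_mul_self, Finset.sum_mul, Complex.ofReal_sum]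
  refine Finset.sum_congr rfl fun i _ => ?_
  simp only [uniformAmp, ← Complex.ofReal_mul]
  congr 1
  ring

theorem signedAmp_dotProduct (m : ℕ) (f : Fin (4 * m + 2) → ℝ) :
    signedAmp m ⬝ᵥ (fun i => (f i : ℂ) * uniformAmp m i) =
      (((∑ i ∈ leftHalf m, f i - ∑ i ∈ rightHalf m, f i) * (4 * m + 2 : ℝ)⁻¹ : ℝ) : ℂ) := by
  have h : signedAmp m ⬝ᵥ (fun i => (f i : ℂ) * uniformAmp m i) =
      uniformAmp m ⬝ᵥ (fun i => (((if i ∈ leftHalf m then 1 else -1) * f i : ℝ) : ℂ) *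
        uniformAmp m i) := by
    refine Finset.sum_congr rfl fun i _ => ?_
    simp only [uniformAmp, signedAmp, ← Complex.ofReal_mul]
    congr 1
    ring
  have hl : ∑ i ∈ leftHalf m, (if i ∈ leftHalf m then 1 else -1) * f i =
      ∑ i ∈ leftHalf m, f i :=
    Finset.sum_congr rfl fun i hi => by rw [if_pos hi, one_mul]
  have hr : ∑ i ∈ rightHalf m, (if i ∈ leftHalf m then 1 else -1) * f i =
      -∑ i ∈ rightHalf m, f i := by
    rw [← Finset.sum_neg_distrib]
    refine Finset.sum_congr rfl fun i hi => ?_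
    rw [if_neg (Finset.disjoint_right.1 (disjoint_leftHalf_rightHalf m) hi), neg_one_mul]
  rw [h, uniformAmp_dotProduct, hl, hr, sub_eq_add_neg]

theorem uniformAmp_dotProduct_self (m : ℕ) : uniformAmp m ⬝ᵥ uniformAmp m = 1 := by
  have h := uniformAmp_dotProduct m fun _ => 1
  simp only [Complex.ofReal_one, one_mul, Finset.sum_const, card_leftHalf, card_rightHalf] at h
  refine h.trans ?_
  norm_cast
  rw [nsmul_eq_mul]
  push_cast
  field_simp
  ring

theorem signedAmp_dotProduct_uniformAmp (m : ℕ) : signedAmp m ⬝ᵥ uniformAmp m = 0 := by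
  have h := signedAmp_dotProduct m fun _ => 1
  simpa [card_leftHalf, card_rightHalf] using h

theorem signedAmp_dotProduct_self (m : ℕ) : signedAmp m ⬝ᵥ signedAmp m = 1 := by
  rw [← uniformAmp_dotProduct_self]
  refine Finset.sum_congr rfl fun i _ => ?_
  simp only [uniformAmp, signedAmp, ← Complex.ofReal_mul]
  split_ifs <;> ring_nf

/-- The unitary that exchanges the uniform and the signed superposition of the indices with the flag
states for the outputs `1` and `-1`. -/
noncomputable def flagUnitary (m : ℕ) : Matrix.unitaryGroup (RegisterBasis (4 * m + 2) 0) ℂ :=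
  ⟨doubleReflection (flagVector (uniformAmp m) 1) (flagVector (signedAmp m) (-1)),
    doubleReflection_mem_unitaryGroup (star_flagVector (star_uniformAmp m) 1)
      (star_flagVector (star_signedAmp m) (-1))
      (by rw [flagVector_dotProduct_flagVector, uniformAmp_dotProduct_self, if_pos rfl]; norm_num)
      (by rw [flagVector_dotProduct_flagVector, signedAmp_dotProduct_self, if_pos rfl]; norm_num)
      (by rw [flagVector_dotProduct_flagVector, dotProduct_comm, signedAmp_dotProduct_uniformAmp,
        if_neg (by decide), add_zero])⟩

/-- The unitary that multiplies by the value of the query target qubit. -/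
noncomputable def phaseUnitary (n k : ℕ) : Matrix.unitaryGroup (RegisterBasis n k) ℂ :=
  ⟨Matrix.diagonal fun v => (toReal v.2.2.2.1 : ℂ), by
    rw [Matrix.mem_unitaryGroup_iff, Matrix.star_eq_conjTranspose, Matrix.diagonal_conjTranspose,
      Matrix.diagonal_mul_diagonal, ← Matrix.diagonal_one]
    congr 1
    funext v
    rcases Int.units_eq_one_or v.2.2.2.1 with h | h <;> simp [h, toReal]⟩

/-- The two-query algorithm for the Imbalance function: from the uniform superposition of the
indices, it computes `x i` into the query target qubit, uses it as a phase, and uncomputes it. -/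
noncomputable def imbalanceAlgorithm (m : ℕ) : QueryAlgorithm (4 * m + 2) 2 where
  ancillas := 0
  init := flagBasis m 1
  unitary := ![flagUnitary m, phaseUnitary _ _, flagUnitary m]

theorem flagUnitary_mulVec_single (m : ℕ) :
    (flagUnitary m).1.mulVec (Pi.single (flagBasis m 1) 1) = indexState (uniformAmp m) := by
  rw [flagUnitary, doubleReflection_mulVec, flagVector_dotProduct_single,
    flagVector_dotProduct_single, if_pos rfl, if_neg (by decide), flagVector]
  simp

theorem applyQuery_phaseUnitary_applyQuery_indexState {n : ℕ} (x : Cube n) (c : Fin n → ℂ) :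
    applyQuery x ((phaseUnitary n 0).1.mulVec (applyQuery x (indexState c))) =
      indexState fun i => (toReal (x i) : ℂ) * c i := by
  funext v
  simp only [applyQuery, phaseUnitary, Matrix.mulVec_diagonal, indexState, mul_assoc,
    Int.units_mul_self, mul_one]
  split_ifs with h
  · rw [h.2.2, one_mul]
  · rw [mul_zero]

/-- The final state of the algorithm. -/
noncomputable def imbalanceState (m : ℕ) (x : Cube (4 * m + 2)) : RegisterState (4 * m + 2) 0 :=
  (flagUnitary m).1.mulVec (indexState fun i => (toReal (x i) : ℂ) * uniformAmp m i)

open Classical in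
theorem prob_imbalanceAlgorithm (m : ℕ) (x : Cube (4 * m + 2))
    (E : Set (RegisterBasis (4 * m + 2) 0)) : (imbalanceAlgorithm m).prob x E =
      ∑ v, if v ∈ E then ‖imbalanceState m x v‖ ^ 2 else 0 := by
  have h : (imbalanceAlgorithm m).finalState x = imbalanceState m x := by
    rw [imbalanceState, ← applyQuery_phaseUnitary_applyQuery_indexState,
      ← flagUnitary_mulVec_single]
    rfl
  rw [← h]
  rfl

/-- Index states vanish where the post-selection bit is `true`, so only the `-1` entries of the two
flag vectors contribute, weighted by the overlaps with the uniform and signed amplitudes. -/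
theorem imbalanceState_of_flag {m : ℕ} (x : Cube (4 * m + 2))
    {v : RegisterBasis (4 * m + 2) 0} (hv : v.2.1 = true) :
    imbalanceState m x v =
      (((partSum (leftHalf m) x + partSum (rightHalf m) x) * (4 * m + 2 : ℝ)⁻¹ : ℝ) : ℂ) *
          Pi.single (M := fun _ => ℂ) (flagBasis m 1) 1 v +
        (((partSum (leftHalf m) x - partSum (rightHalf m) x) * (4 * m + 2 : ℝ)⁻¹ : ℝ) : ℂ) *
          Pi.single (M := fun _ => ℂ) (flagBasis m (-1)) 1 v := by
  have h0 : ∀ c, indexState c v = 0 := fun c => if_neg (by simp [hv])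
  rw [imbalanceState, flagUnitary, doubleReflection_mulVec,
    flagVector_dotProduct_indexState, flagVector_dotProduct_indexState, uniformAmp_dotProduct,
    signedAmp_dotProduct]
  simp only [Pi.sub_apply, Pi.smul_apply, smul_eq_mul, flagVector, h0, partSum]
  ring

theorem partSum_of_mem_dom {m : ℕ} {x : Cube (4 * m + 2)} (hx : x ∈ sMinus m ∪ sPlus m) :
    partSum (rightHalf m) x ≠ 0 ∧
      partSum (leftHalf m) x = imbalance m x * partSum (rightHalf m) x := by
  have h : partSum (rightHalf m) x ≠ 0 := by
    -- If `R` were `0`, the convention `a / 0 = 0` would make the imbalance `0`, not `±1`.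
    intro h
    rcases hx with hx | hx
    · have := imbalance_of_mem_sMinus hx
      rw [imbalance, h, div_zero] at this
      norm_num at this
    · have := imbalance_of_mem_sPlus hx
      rw [imbalance, h, div_zero] at this
      norm_num at this
  exact ⟨h, (div_mul_cancel₀ _ h).symm⟩

theorem imbalanceState_eq_zero {m : ℕ} {x : Cube (4 * m + 2)} (hx : x ∈ sMinus m ∪ sPlus m)
    {v : RegisterBasis (4 * m + 2) 0} (hv : v.2.1 = true) (ha : toReal v.1 ≠ imbalance m x) :
    imbalanceState m x v = 0 := by
  have hf : imbalance m x = 1 ∨ imbalance m x = -1 := (boolImbalance m).val_eq ⟨x, hx⟩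
  rw [imbalanceState_of_flag x hv, (partSum_of_mem_dom hx).2]
  rcases hf with hf | hf
  · have : v ≠ flagBasis m 1 := by
      rintro rfl
      exact ha (by simp [hf, toReal, flagBasis])
    rw [Pi.single_eq_of_ne this, hf]
    simp
  · have : v ≠ flagBasis m (-1) := by
      rintro rfl
      exact ha (by simp [hf, toReal, flagBasis])
    rw [Pi.single_eq_of_ne this, hf]
    simp

theorem exists_imbalanceState_ne_zero {m : ℕ} {x : Cube (4 * m + 2)}
    (hx : x ∈ sMinus m ∪ sPlus m) : ∃ a, imbalanceState m x (flagBasis m a) ≠ 0 := by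
  have hf : imbalance m x = 1 ∨ imbalance m x = -1 := (boolImbalance m).val_eq ⟨x, hx⟩
  obtain ⟨hR, hL⟩ := partSum_of_mem_dom hx
  have hn : (4 * m + 2 : ℝ)⁻¹ ≠ 0 := by positivity
  have hne : flagBasis m 1 ≠ flagBasis m (-1) := (flagBasis_injective m).ne (by decide)
  rcases hf with hf | hf
  · refine ⟨1, ?_⟩
    rw [imbalanceState_of_flag x rfl, hL, hf, Pi.single_eq_same, Pi.single_eq_of_ne hne, mul_one,
      mul_zero, add_zero, one_mul, ← two_mul, Complex.ofReal_ne_zero]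
    exact mul_ne_zero (mul_ne_zero two_ne_zero hR) hn
  · refine ⟨-1, ?_⟩
    rw [imbalanceState_of_flag x rfl, hL, hf, Pi.single_eq_same, Pi.single_eq_of_ne hne.symm,
      mul_one, mul_zero, zero_add, neg_one_mul, ← neg_add', ← two_mul, Complex.ofReal_ne_zero]
    exact mul_ne_zero (neg_ne_zero.2 (mul_ne_zero two_ne_zero hR)) hn

theorem imbalanceAlgorithm_postComputes (m : ℕ) :
    (imbalanceAlgorithm m).PostComputes 0 (boolImbalance m) := by
  classical
  rintro ⟨x, hx⟩
  have hpos : 0 < (imbalanceAlgorithm m).prob x {v | v.2.1 = true} := by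
    obtain ⟨a, ha⟩ := exists_imbalanceState_ne_zero hx
    refine lt_of_lt_of_eq ?_ (prob_imbalanceAlgorithm m x {v | v.2.1 = true}).symm
    refine Finset.sum_pos' (fun v _ => by split_ifs <;> positivity)
      ⟨flagBasis m a, Finset.mem_univ _, ?_⟩
    rw [if_pos (show flagBasis m a ∈ {v : RegisterBasis (4 * m + 2) 0 | v.2.1 = true} from rfl)]
    positivity
  have heq : (imbalanceAlgorithm m).prob x {v | toReal v.1 = imbalance m x ∧ v.2.1 = true} =
      (imbalanceAlgorithm m).prob x {v | v.2.1 = true} := by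
    refine (prob_imbalanceAlgorithm m x {v | toReal v.1 = imbalance m x ∧ v.2.1 = true}).trans
      (Eq.trans ?_ (prob_imbalanceAlgorithm m x {v | v.2.1 = true}).symm)
    refine Finset.sum_congr rfl fun v _ => ?_
    by_cases hv : v.2.1 = true
    · by_cases ha : toReal v.1 = imbalance m x
      · simp [hv, ha]
      · simp [imbalanceState_eq_zero hx hv ha]
    · simp [hv]
  exact ⟨hpos, (sub_zero (1 : ℝ)).trans_le ((div_self hpos.ne').symm.trans_le
    (le_of_eq (congrArg (· / _) heq.symm)))⟩

/-! ### Rational degree and the final bounds -/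

theorem ratDeg_boolImbalance_le (m : ℕ) : ratDeg (boolImbalance m) ≤ 1 := by
  have hdeg : ∀ s : Finset (Fin (4 * m + 2)),
      (∑ i ∈ s, MvPolynomial.X i : MvPolynomial (Fin (4 * m + 2)) ℝ).totalDegree ≤ 1 := fun s =>
    MvPolynomial.totalDegree_finsetSum_le fun i _ => (MvPolynomial.totalDegree_X i).le
  have heval : ∀ (s : Finset (Fin (4 * m + 2))) (x : Cube (4 * m + 2)),
      evalCube (∑ i ∈ s, MvPolynomial.X i) x = partSum s x := by
    intro s x
    simp [evalCube, partSum]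
  refine (iInf₂_le (∑ i ∈ leftHalf m, MvPolynomial.X i) (∑ i ∈ rightHalf m, MvPolynomial.X i)).trans
    ((iInf_le _ ?_).trans ?_)
  · rintro ⟨x, hx⟩
    rw [heval, heval]
    refine ⟨(partSum_of_mem_dom hx).1, le_of_eq ?_⟩
    exact abs_eq_zero.2 (sub_self _)
  · exact_mod_cast max_le (hdeg _) (hdeg _)

theorem postQueryExact_boolImbalance_le (m : ℕ) : postQueryExact (boolImbalance m) ≤ 2 :=
  iInf₂_le 2 ⟨imbalanceAlgorithm m, imbalanceAlgorithm_postComputes m⟩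

theorem ofReal_le_natCast_of_mul_le {n k d : ℕ} (hk : 0 < k) (h : n ≤ k * d) :
    ENNReal.ofReal (1 / k * n) ≤ ((d : ℕ∞) : ℝ≥0∞) := by
  have hk' : (0 : ℝ) < k := by exact_mod_cast hk
  have h' : (n : ℝ) ≤ k * d := by exact_mod_cast h
  rw [ENat.toENNReal_coe, ← ENNReal.ofReal_natCast]
  refine ENNReal.ofReal_le_ofReal ?_
  rw [one_div_mul_eq_div, div_le_iff₀' hk']
  exact h'

theorem le_approxDeg_boolImbalance (m : ℕ) :
    ENNReal.ofReal (1 / 82 * ((4 * m + 2 : ℕ) : ℝ)) ≤ (approxDeg (boolImbalance m) : ℝ≥0∞) := by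
  simp only [approxDeg, approxDegEps, ENat.toENNReal_iInf, le_iInf_iff]
  exact fun p hp => ofReal_le_natCast_of_mul_le (by norm_num) (le_totalDegree_of_approximates hp)

theorem le_quantumQuery_boolImbalance (m : ℕ) :
    ENNReal.ofReal (1 / 164 * ((4 * m + 2 : ℕ) : ℝ)) ≤
      (quantumQuery (boolImbalance m) : ℝ≥0∞) := by
  simp only [quantumQuery, quantumQueryEps, ENat.toENNReal_iInf, le_iInf_iff]
  exact fun T ⟨_, hA⟩ => ofReal_le_natCast_of_mul_le (by norm_num) (le_of_computes hA)

end BooleanImbalance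

theorem mainTheorem8 :
    (∀ m : ℕ, 1 ≤ m → ∃ A : BooleanImbalance.QueryAlgorithm (4 * m + 2) 2,
      A.PostComputes 0 (BooleanImbalance.boolImbalance m)) ∧
    (∃ C : ℕ, ∀ m : ℕ, 1 ≤ m →
      BooleanImbalance.ratDeg (BooleanImbalance.boolImbalance m) ≤ (C : ℕ∞)) ∧
    (∃ c : ℝ, 0 < c ∧ ∀ m : ℕ, 1 ≤ m → ENNReal.ofReal (c * ((4 * m + 2 : ℕ) : ℝ)) ≤
      (BooleanImbalance.approxDeg (BooleanImbalance.boolImbalance m) : ℝ≥0∞)) ∧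
    (∃ C : ℕ, ∀ m : ℕ, 1 ≤ m →
      BooleanImbalance.postQueryExact (BooleanImbalance.boolImbalance m) ≤ (C : ℕ∞)) ∧
    (∃ c : ℝ, 0 < c ∧ ∀ m : ℕ, 1 ≤ m → ENNReal.ofReal (c * ((4 * m + 2 : ℕ) : ℝ)) ≤
      (BooleanImbalance.quantumQuery (BooleanImbalance.boolImbalance m) : ℝ≥0∞)) :=
  ⟨fun m _ => ⟨_, BooleanImbalance.imbalanceAlgorithm_postComputes m⟩,
    ⟨1, fun m _ => by exact_mod_cast BooleanImbalance.ratDeg_boolImbalance_le m⟩,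
    ⟨1 / 82, by norm_num, fun m _ => BooleanImbalance.le_approxDeg_boolImbalance m⟩,
    ⟨2, fun m _ => by exact_mod_cast BooleanImbalance.postQueryExact_boolImbalance_le m⟩,
    ⟨1 / 164, by norm_num, fun m _ => BooleanImbalance.le_quantumQuery_boolImbalance m⟩⟩
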